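/- Consider a radial distribution grid: a tree on the buses $0,1,\dots,N$ with root (substation) $0$, whose $N$ lines $\ell$ have resistances $r_\ell\in\mathbb R$ and reactances $x_\ell>0$. Let $M\in\mathbb R^{N\times N}$ be the signed incidence matrix of the tree with the row of bus $0$ removed, let $R=M^{-\top}\operatorname{diag}(r)M^{-1}$ and $X=M^{-\top}\operatorname{diag}(x)M^{-1}$, and for a fixed vector $p\in\mathbb R^N$ of active power injections let $\hat v=Rp+\mathbf 1$. Let an arbitrary undirected communication graph on $\{1,\dots,N\}$ be given, let $\mathcal N_i$ be the set of neighbors of $i$ in it, and for each $i$ let $\phi_i:\mathbb R^{|\mathcal N_i|+1}\to\mathcal Q_i=[q_{i,\min},q_{i,\max}]$ be a continuous function of $(v_i,\{v_j\}_{j\in\mathcal N_i})$. Write $\phi(v)=\big(\phi_i(v_i,\{v_j\}_{j\in\mathcal N_i})\big)_{i=1}^N$ for $v\in\mathbb R^N$. For a stepsize $\epsilon\in(0,1]$ consider the closed-loop system $$q(t+1)=q(t)+\epsilon\big(\phi(v(t))-q(t)\big),\qquad v(t+1)=Xq(t+1)+\hat v .$$ Suppose that $\phi$ is monotonically decreasing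 in the collective sense, i.e. $$\big(\phi(v)-\phi(v')\big)^\top(v-v')\le 0\qquad\text{for all } v,v'\in\mathbb R^N,$$ or equivalently $\sum_{i=1}^N\big(\phi_i(v_i,\{v_j\}_{j\in\mathcal N_i})-\phi_i(v'_i,\{v'_j\}_{j\in\mathcal N_i})\big)(v_i-v'_i)\le 0$ for all $v,v'\in\mathbb R^N$. Then there is exactly one pair $(v^\star,q^\star)\in\mathbb R^N\times\mathbb R^N$ with $$\phi(v^\star)=q^\star,\qquad v^\star=Xq^\star+\hat v,$$ and for every $\epsilon\in(0,1]$ this pair is the unique equilibrium (fixed point) of the closed-loop system. -/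

import Mathlib

open Matrix

noncomputable section

/-- A radial distribution grid with buses `0, …, N` (bus `0` is the substation): a tree on the
buses whose `N` lines are labelled by `Fin N` (each edge of the tree carries exactly one label),
line `l` running from `src l` to `dst l`, with resistance `r l` and reactance `x l > 0`.
The orientation of the lines is arbitrary. -/
structure RadialGrid (N : ℕ) where
  graph : SimpleGraph (Fin (N + 1))
  isTree : graph.IsTree
  src : Fin N → Fin (N + 1)
  dst : Fin N → Fin (N + 1)
  adj : ∀ l, graph.Adj (src l) (dst l)
  lines_bijective :
    Function.Bijective (fun l => (⟨s(src l, dst l), adj l⟩ : graph.edgeSet))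
  r : Fin N → ℝ
  x : Fin N → ℝ
  x_pos : ∀ l, 0 < x l

namespace RadialGrid

variable {N : ℕ} (g : RadialGrid N)

/-- The full `(N + 1) × N` signed incidence matrix. -/
def fullIncidence : Matrix (Fin (N + 1)) (Fin N) ℝ :=
  Matrix.of fun n l => if n = g.src l then 1 else if n = g.dst l then -1 else 0

/-- The incidence matrix `M` with the row of the substation removed;
row `i : Fin N` belongs to bus `i.succ`. -/
def incidence : Matrix (Fin N) (Fin N) ℝ :=
  g.fullIncidence.submatrix Fin.succ id

/-- `R = M⁻ᵀ D_r M⁻¹`. -/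
def R : Matrix (Fin N) (Fin N) ℝ :=
  (g.incidence⁻¹)ᵀ * Matrix.diagonal g.r * g.incidence⁻¹

/-- `X = M⁻ᵀ D_x M⁻¹`. -/
def X : Matrix (Fin N) (Fin N) ℝ :=
  (g.incidence⁻¹)ᵀ * Matrix.diagonal g.x * g.incidence⁻¹

/-- `v̂ = R p + 1`, for the constant active power injections `p`. -/
def vHat (p : Fin N → ℝ) : Fin N → ℝ :=
  g.R *ᵥ p + 1

end RadialGrid

/-- The buses whose voltage is available to bus `i`: itself and its neighbours in the
communication network `comm`. -/
abbrev Accessible {N : ℕ} (comm : SimpleGraph (Fin N)) (i : Fin N) : Type :=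
  {j : Fin N // j = i ∨ comm.Adj i j}

/-- Equilibrium functions over the communication network `comm`: `φ i` maps the accessible
voltages of bus `i` into the interval `[qmin i, qmax i]`. -/
abbrev EquilibriumFunctions {N : ℕ} (comm : SimpleGraph (Fin N)) (qmin qmax : Fin N → ℝ) : Type :=
  (i : Fin N) → (Accessible comm i → ℝ) → Set.Icc (qmin i) (qmax i)

namespace EquilibriumFunctions

variable {N : ℕ} {comm : SimpleGraph (Fin N)} {qmin qmax : Fin N → ℝ}

/-- The stacked function `v ↦ (φ_i(v_i, {v_j}))_i`. -/
def stack (φ : EquilibriumFunctions comm qmin qmax) (v : Fin N → ℝ) : Fin N → ℝ :=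
  fun i => (φ i (fun j => v j.1) : ℝ)

/-- `φ` is collectively monotonically decreasing: `(φ(v) - φ(v'))ᵀ (v - v') ≤ 0`. -/
def CollectivelyDecreasing (φ : EquilibriumFunctions comm qmin qmax) : Prop :=
  ∀ v v' : Fin N → ℝ, (φ.stack v - φ.stack v') ⬝ᵥ (v - v') ≤ 0

end EquilibriumFunctions

/-- One step `(v(t), q(t)) ↦ (v(t+1), q(t+1))` of the closed-loop system with stepsize `ε`:
`q(t+1) = q(t) + ε (φ(v(t)) - q(t))`, `v(t+1) = X q(t+1) + v̂`. -/
def closedLoopStep {N : ℕ} (g : RadialGrid N) (p : Fin N → ℝ) {comm : SimpleGraph (Fin N)}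
    {qmin qmax : Fin N → ℝ} (φ : EquilibriumFunctions comm qmin qmax) (ε : ℝ)
    (s : (Fin N → ℝ) × (Fin N → ℝ)) : (Fin N → ℝ) × (Fin N → ℝ) :=
  (g.X *ᵥ (s.2 + ε • (φ.stack s.1 - s.2)) + g.vHat p, s.2 + ε • (φ.stack s.1 - s.2))

end

/-! ### Positive definiteness of `X`. -/

namespace RadialGrid

variable {N : ℕ} (g : RadialGrid N)

/-! `M` is invertible and `x > 0`, so `X` is positive definite. Uniqueness: for two solutions with
difference `d`, monotonicity of `φ` gives `dᵀ X d ≤ 0`, so `d = 0`. Existence avoids Brouwer: `q ↦ X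
(q - φ(X q + v̂))` is monotone, so its variational inequality on the box of the `qmin`, `qmax` is
solvable by Hahn–Banach and compactness (`exists_variational_inequality`), and the solution is a
fixed point. -/

theorem vecMul_incidence_apply (u : Fin N → ℝ) (l : Fin N) :
    (u ᵥ* g.incidence) l =
      (Fin.cons 0 u : Fin (N + 1) → ℝ) (g.src l) - (Fin.cons 0 u : Fin (N + 1) → ℝ) (g.dst l) := by
  have hne : g.src l ≠ g.dst l := (g.adj l).ne
  have hsum : (u ᵥ* g.incidence) l =
      ∑ n : Fin (N + 1), (Fin.cons 0 u : Fin (N + 1) → ℝ) n * g.fullIncidence n l := by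
    rw [Fin.sum_univ_succ]
    simp [Matrix.vecMul, dotProduct, incidence]
  have hentry : ∀ n, g.fullIncidence n l =
      (if n = g.src l then 1 else 0) - (if n = g.dst l then 1 else 0) := by
    intro n
    simp only [fullIncidence, Matrix.of_apply]
    split_ifs with h₁ h₂
    · exact absurd (h₁.symm.trans h₂) hne
    all_goals norm_num
  rw [hsum]
  simp only [hentry, mul_sub, Finset.sum_sub_distrib, mul_ite, mul_one, mul_zero,
    Finset.sum_ite_eq', Finset.mem_univ, if_true]

/-- The reduced incidence matrix of a tree is invertible. -/
theorem isUnit_incidence : IsUnit g.incidence := by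
  rw [← Matrix.vecMul_injective_iff_isUnit]
  refine (injective_iff_map_eq_zero g.incidence.vecMulLinear).2 fun u hu => ?_
  -- With value `0` at the substation, a left kernel vector is constant along every line, hence zero
  -- by connectedness.
  set w : Fin (N + 1) → ℝ := Fin.cons 0 u
  have hadj : ∀ a b, g.graph.Adj a b → w a = w b := by
    intro a b hab
    obtain ⟨l, hl⟩ := g.lines_bijective.2 ⟨s(a, b), hab⟩
    have hl' : s(g.src l, g.dst l) = s(a, b) := congrArg Subtype.val hl
    have hz : w (g.src l) - w (g.dst l) = 0 := by
      rw [← vecMul_incidence_apply]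
      exact congrFun hu l
    rcases Sym2.eq_iff.1 hl' with ⟨h₁, h₂⟩ | ⟨h₁, h₂⟩ <;> rw [h₁, h₂] at hz <;> linarith
  have hreach : ∀ a b, g.graph.Reachable a b → w a = w b := by
    rintro a b ⟨walk⟩
    induction walk with
    | nil => rfl
    | cons h _ ih => exact (hadj _ _ h).trans ih
  funext i
  simpa [w] using hreach i.succ 0 (g.isTree.connected.preconnected _ _)

theorem dotProduct_X_mulVec (q : Fin N → ℝ) :
    q ⬝ᵥ g.X *ᵥ q = ∑ l, g.x l * (g.incidence⁻¹ *ᵥ q) l ^ 2 := by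
  rw [X, ← Matrix.mulVec_mulVec, ← Matrix.mulVec_mulVec, Matrix.dotProduct_mulVec,
    Matrix.vecMul_transpose]
  simp only [dotProduct, Matrix.mulVec_diagonal]
  exact Finset.sum_congr rfl fun l _ => by ring

theorem dotProduct_X_mulVec_nonneg (q : Fin N → ℝ) : 0 ≤ q ⬝ᵥ g.X *ᵥ q := by
  rw [dotProduct_X_mulVec]
  exact Finset.sum_nonneg fun l _ => mul_nonneg (g.x_pos l).le (sq_nonneg _)

theorem eq_zero_of_dotProduct_X_mulVec_nonpos {q : Fin N → ℝ} (h : q ⬝ᵥ g.X *ᵥ q ≤ 0) :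
    q = 0 := by
  rw [dotProduct_X_mulVec] at h
  have hnn : ∀ l ∈ Finset.univ, 0 ≤ g.x l * (g.incidence⁻¹ *ᵥ q) l ^ 2 :=
    fun l _ => mul_nonneg (g.x_pos l).le (sq_nonneg _)
  have hz := (Finset.sum_eq_zero_iff_of_nonneg hnn).1 (le_antisymm h (Finset.sum_nonneg hnn))
  have hM : g.incidence⁻¹ *ᵥ q = 0 := by
    funext l
    simpa [(g.x_pos l).ne'] using hz l (Finset.mem_univ l)
  have := congrArg (g.incidence *ᵥ ·) hM
  simpa [Matrix.mulVec_mulVec,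
    Matrix.mul_nonsing_inv _ ((Matrix.isUnit_iff_isUnit_det _).1 g.isUnit_incidence)] using this

end RadialGrid

/-! ### Monotone variational inequalities. -/

section VariationalInequality

variable {n : Type*} [Fintype n]

/-- A monotone map admits a point satisfying finitely many instances of the Minty variational
inequality. -/
theorem exists_minty_finset {K : Set (n → ℝ)} (hK : IsCompact K) (hconv : Convex ℝ K)
    (hne : K.Nonempty) {T : (n → ℝ) → n → ℝ}
    (hT : ∀ a ∈ K, ∀ b ∈ K, 0 ≤ (T a - T b) ⬝ᵥ (a - b)) {s : Finset (n → ℝ)} (hs : ↑s ⊆ K) :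
    ∃ q ∈ K, ∀ y ∈ s, 0 ≤ T y ⬝ᵥ (y - q) := by
  classical
  by_contra! hcon
  let L : (n → ℝ) →ₗ[ℝ] s → ℝ :=
    { toFun := fun q y => -(T y ⬝ᵥ q)
      map_add' := fun a b => by funext y; simp [dotProduct_add]; ring
      map_smul' := fun c a => by funext y; simp }
  let c : s → ℝ := fun y => T y ⬝ᵥ y
  have hB : ∀ q (y : s), (c + L q) y = T y ⬝ᵥ (y - q) := fun q y => by
    simp [L, c, sub_eq_add_neg]
  have himc : IsCompact ((fun q => c + L q) '' K) :=
    hK.image (continuous_const.add L.continuous_of_finiteDimensional)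
  have himv : Convex ℝ ((fun q => c + L q) '' K) := by
    have := (hconv.linear_image L).translate c
    rwa [Set.image_image] at this
  have hdisj : Disjoint ((fun q => c + L q) '' K) (Set.Ici 0) := by
    rw [Set.disjoint_left]
    rintro _ ⟨q, hq, rfl⟩ hpos
    obtain ⟨y, hy, hlt⟩ := hcon q hq
    exact absurd ((hpos ⟨y, hy⟩).trans_eq (hB q ⟨y, hy⟩)) (not_le.2 hlt)
  -- If no `q` works, the affine image of `K` misses the nonnegative orthant; the separating
  -- functional has nonnegative weights `μ`.
  obtain ⟨f, u, v, hfu, huv, hfv⟩ :=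
    geometric_hahn_banach_compact_closed himv himc
      (convex_Ici (𝕜 := ℝ) (0 : s → ℝ)) isClosed_Ici hdisj
  have hv : v < 0 := by simpa using hfv 0 (Set.mem_Ici.2 le_rfl)
  let μ : s → ℝ := fun y => f (Pi.single y 1)
  have hf : ∀ a, f a = ∑ y, μ y * a y := fun a => by
    conv_lhs => rw [pi_eq_sum_univ' a]
    simp [map_sum, μ, mul_comm]
  have hμ : ∀ y, 0 ≤ μ y := by
    intro y
    by_contra! hy
    have hmem : (v / μ y) • (Pi.single y 1 : s → ℝ) ∈ Set.Ici (0 : s → ℝ) :=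
      Set.mem_Ici.2 <|
        smul_nonneg (div_nonneg_of_nonpos hv.le hy.le) (Pi.single_nonneg.2 zero_le_one)
    have := hfv _ hmem
    rw [map_smul, smul_eq_mul, div_mul_cancel₀ _ hy.ne] at this
    exact lt_irrefl _ this
  have hneg : ∀ q ∈ K, ∑ y : s, μ y * (T y ⬝ᵥ (y - q)) < 0 := fun q hq => by
    have := hfu _ ⟨q, hq, rfl⟩
    rw [hf] at this
    simp only [hB] at this
    linarith
  have hm : 0 < ∑ y, μ y := by
    refine lt_of_le_of_ne (Finset.sum_nonneg fun y _ => hμ y) fun h0 => ?_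
    have hz := (Finset.sum_eq_zero_iff_of_nonneg fun y _ => hμ y).1 h0.symm
    obtain ⟨q, hq⟩ := hne
    have := hneg q hq
    rw [Finset.sum_eq_zero fun y hy => by rw [hz y hy, zero_mul]] at this
    exact lt_irrefl _ this
  -- At the barycentre the weighted sum with `T q` in place of `T y` vanishes, so monotonicity
  -- contradicts `hneg`.
  let q : n → ℝ := Finset.univ.centerMass μ (fun y : s => (y : n → ℝ))
  have hq : q ∈ K := hconv.centerMass_mem (fun y _ => hμ y) hm fun y _ => hs y.2
  have hbal : ∑ y : s, μ y • ((y : n → ℝ) - q) = 0 := by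
    simp only [smul_sub, Finset.sum_sub_distrib, ← Finset.sum_smul]
    simp only [q, Finset.centerMass]
    rw [smul_inv_smul₀ hm.ne', sub_self]
  have hTq : ∑ y : s, μ y * (T q ⬝ᵥ (y - q)) = 0 := by
    have := congrArg (T q ⬝ᵥ ·) hbal
    simpa [dotProduct_sum] using this
  have hnn : 0 ≤ ∑ y : s, μ y * ((T y - T q) ⬝ᵥ (y - q)) :=
    Finset.sum_nonneg fun y _ => mul_nonneg (hμ y) (hT _ (hs y.2) _ hq)
  simp only [sub_dotProduct, mul_sub, Finset.sum_sub_distrib] at hnn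
  linarith [hneg q hq]

/-- The Minty variational inequality for a monotone map on a compact convex set. -/
theorem exists_minty {K : Set (n → ℝ)} (hK : IsCompact K) (hconv : Convex ℝ K)
    (hne : K.Nonempty) {T : (n → ℝ) → n → ℝ}
    (hT : ∀ a ∈ K, ∀ b ∈ K, 0 ≤ (T a - T b) ⬝ᵥ (a - b)) :
    ∃ q ∈ K, ∀ y ∈ K, 0 ≤ T y ⬝ᵥ (y - q) := by
  classical
  obtain ⟨q, hq, hqs⟩ := hK.inter_iInter_nonempty
    (fun y : K => {q : n → ℝ | 0 ≤ T y ⬝ᵥ (y - q)})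
    (fun y => isClosed_le continuous_const (by simp only [dotProduct]; fun_prop)) fun t => by
      obtain ⟨q, hq, h⟩ := exists_minty_finset hK hconv hne hT
        (s := t.image Subtype.val) (by intro y hy; simp at hy; exact hy.1)
      refine ⟨q, hq, Set.mem_iInter₂.2 fun y hy => h y (Finset.mem_image_of_mem _ hy)⟩
  exact ⟨q, hq, fun y hy => Set.mem_iInter.1 hqs ⟨y, hy⟩⟩

/-- The Stampacchia variational inequality for a continuous monotone map on a compact convex
set. -/
theorem exists_variational_inequality {K : Set (n → ℝ)} (hK : IsCompact K) (hconv : Convex ℝ K)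
    (hne : K.Nonempty) {T : (n → ℝ) → n → ℝ} (hcont : Continuous T)
    (hT : ∀ a ∈ K, ∀ b ∈ K, 0 ≤ (T a - T b) ⬝ᵥ (a - b)) :
    ∃ q ∈ K, ∀ y ∈ K, 0 ≤ T q ⬝ᵥ (y - q) := by
  obtain ⟨q, hq, h⟩ := exists_minty hK hconv hne hT
  refine ⟨q, hq, fun y hy => ?_⟩
  have hlim : Filter.Tendsto (fun t : ℝ => T (q + t • (y - q)) ⬝ᵥ (y - q))
      (nhdsWithin 0 (Set.Ioi 0)) (nhds (T q ⬝ᵥ (y - q))) := by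
    have hc : Continuous fun t : ℝ => T (q + t • (y - q)) ⬝ᵥ (y - q) := by
      simp only [dotProduct]; fun_prop
    have := hc.tendsto 0
    simp only [zero_smul, add_zero] at this
    exact this.mono_left nhdsWithin_le_nhds
  refine ge_of_tendsto hlim ?_
  filter_upwards [Ioo_mem_nhdsGT (zero_lt_one (α := ℝ))] with t ht
  -- Minty's trick: test at a point of the segment from `q` to `y` and divide by `t`.
  have := h _ (hconv.add_smul_sub_mem hq hy ⟨ht.1.le, ht.2.le⟩)
  rw [add_sub_cancel_left, dotProduct_smul, smul_eq_mul] at this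
  exact nonneg_of_mul_nonneg_right this ht.1

end VariationalInequality

/-! ### Existence and uniqueness of the equilibrium. -/

namespace EquilibriumFunctions

variable {N : ℕ} {comm : SimpleGraph (Fin N)} {qmin qmax : Fin N → ℝ}
  {φ : EquilibriumFunctions comm qmin qmax}

theorem continuous_stack (hcont : ∀ i, Continuous (φ i)) : Continuous φ.stack :=
  continuous_pi fun i => continuous_subtype_val.comp
    ((hcont i).comp (continuous_pi fun j => continuous_apply j.1))

theorem stack_mem_Icc (v : Fin N → ℝ) : φ.stack v ∈ Set.Icc qmin qmax :=
  ⟨fun i => (φ i _).2.1, fun i => (φ i _).2.2⟩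

theorem CollectivelyDecreasing.exists_stack_eq (hφ : φ.CollectivelyDecreasing)
    (hcont : ∀ i, Continuous (φ i)) (g : RadialGrid N) (w : Fin N → ℝ) :
    ∃ q, φ.stack (g.X *ᵥ q + w) = q := by
  have hstack := continuous_stack hcont
  obtain ⟨q, -, h⟩ := exists_variational_inequality (K := Set.Icc qmin qmax)
    (T := fun q => (q - φ.stack (g.X *ᵥ q + w)) ᵥ* g.X) isCompact_Icc (convex_Icc _ _)
    ⟨_, stack_mem_Icc (φ := φ) 0⟩ (by fun_prop) (by
      intro a _ b _
      have h₁ := g.dotProduct_X_mulVec_nonneg (a - b)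
      have h₂ := hφ (g.X *ᵥ a + w) (g.X *ᵥ b + w)
      rw [add_sub_add_right_eq_sub, ← Matrix.mulVec_sub] at h₂
      rw [← Matrix.sub_vecMul, ← Matrix.dotProduct_mulVec, sub_sub_sub_comm, sub_dotProduct]
      linarith)
  refine ⟨q, ?_⟩
  -- Testing with `y = φ(X q + w)` gives `(q - y)ᵀ X (q - y) ≤ 0`.
  have h₁ := h _ (stack_mem_Icc (φ := φ) (g.X *ᵥ q + w))
  rw [← Matrix.dotProduct_mulVec, ← neg_sub, neg_dotProduct] at h₁
  exact sub_eq_zero.1 (g.eq_zero_of_dotProduct_X_mulVec_nonpos (by linarith))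

theorem CollectivelyDecreasing.eq_of_stack_eq (hφ : φ.CollectivelyDecreasing) (g : RadialGrid N)
    {w q q' : Fin N → ℝ} (hq : φ.stack (g.X *ᵥ q + w) = q)
    (hq' : φ.stack (g.X *ᵥ q' + w) = q') : q = q' := by
  have h := hφ (g.X *ᵥ q + w) (g.X *ᵥ q' + w)
  rw [hq, hq', add_sub_add_right_eq_sub, ← Matrix.mulVec_sub] at h
  exact sub_eq_zero.1 (g.eq_zero_of_dotProduct_X_mulVec_nonpos h)

end EquilibriumFunctions

theorem isFixedPt_closedLoopStep_iff {N : ℕ} (g : RadialGrid N) (p : Fin N → ℝ)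
    {comm : SimpleGraph (Fin N)} {qmin qmax : Fin N → ℝ}
    (φ : EquilibriumFunctions comm qmin qmax) {ε : ℝ} (hε : ε ≠ 0) (v q : Fin N → ℝ) :
    Function.IsFixedPt (closedLoopStep g p φ ε) (v, q) ↔
      φ.stack v = q ∧ v = g.X *ᵥ q + g.vHat p := by
  simp only [Function.IsFixedPt, closedLoopStep, Prod.mk.injEq]
  constructor
  · rintro ⟨h₁, h₂⟩
    rw [h₂] at h₁
    rw [add_eq_left, smul_eq_zero_iff_right hε, sub_eq_zero] at h₂
    exact ⟨h₂, h₁.symm⟩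
  · rintro ⟨h₁, h₂⟩
    rw [h₁, sub_self, smul_zero, add_zero]
    exact ⟨h₂.symm, rfl⟩

theorem mainTheorem2 {N : ℕ} (g : RadialGrid N) (p : Fin N → ℝ)
    (comm : SimpleGraph (Fin N)) (qmin qmax : Fin N → ℝ)
    (φ : EquilibriumFunctions comm qmin qmax) (hcont : ∀ i, Continuous (φ i)) :
    (φ.CollectivelyDecreasing ↔
      ∀ v v' : Fin N → ℝ,
        ∑ i, ((φ i (fun j => v j.1) : ℝ) - (φ i (fun j => v' j.1) : ℝ)) * (v i - v' i) ≤ 0) ∧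
    (φ.CollectivelyDecreasing →
      ∃ vs qs : Fin N → ℝ,
        (φ.stack vs = qs ∧ vs = g.X.mulVec qs + g.vHat p) ∧
        (∀ v q : Fin N → ℝ, φ.stack v = q ∧ v = g.X.mulVec q + g.vHat p → v = vs ∧ q = qs) ∧
        (∀ ε : ℝ, 0 < ε → ε ≤ 1 → ∀ v q : Fin N → ℝ,
          Function.IsFixedPt (closedLoopStep g p φ ε) (v, q) ↔ v = vs ∧ q = qs)) := by
  refine ⟨Iff.rfl, fun hφ => ?_⟩
  obtain ⟨qs, hqs⟩ := hφ.exists_stack_eq hcont g (g.vHat p)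
  have huniq : ∀ v q : Fin N → ℝ, φ.stack v = q ∧ v = g.X.mulVec q + g.vHat p →
      v = g.X.mulVec qs + g.vHat p ∧ q = qs := by
    rintro v q ⟨hq, hv⟩
    have hqq : q = qs := hφ.eq_of_stack_eq g (hv ▸ hq) hqs
    exact ⟨hqq ▸ hv, hqq⟩
  refine ⟨g.X.mulVec qs + g.vHat p, qs, ⟨hqs, rfl⟩, huniq, fun ε hε _ v q => ?_⟩
  rw [isFixedPt_closedLoopStep_iff g p φ hε.ne']
  refine ⟨huniq v q, ?_⟩
  rintro ⟨rfl, rfl⟩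
  exact ⟨hqs, rfl⟩
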